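/- Let $\mathcal A,\mathcal B,\mathcal C$ be unital $C^*$-algebras, and write $UCP(\mathcal A,\mathcal B)$ for the set of unital completely positive maps $\mathcal A\to\mathcal B$. A joint representation tuple of $\phi_1,\phi_2\in UCP(\mathcal A,\mathcal B)$ is a tuple $(\mathcal E,\sigma_1,\sigma_2,x)$, where $\mathcal E$ is a (complete, right) Hilbert $\mathcal B$-module, $\sigma_1,\sigma_2:\mathcal A\to\mathcal B^a(\mathcal E)$ are unital $*$-homomorphisms into the $C^*$-algebra of bounded adjointable operators on $\mathcal E$, and $x\in\mathcal E$ satisfies $\langle x,x\rangle=1$ and $\phi_i(a)=\langle x,\sigma_i(a)x\rangle$ for all $a\in\mathcal A$, $i=1,2$. The representation distance is $$\gamma(\phi_1,\phi_2)=\inf\|\sigma_1-\sigma_2\|_{cb},$$ where the infimum is over all joint representation tuples of $(\phi_1,\phi_2)$ and $\|\cdot\|_{cb}$ is the completely bounded norm. Then for all $\phi_1,\phi_2\in UCP(\mathcal A,\mathcal B)$ and $\psi\in UCP(\mathcal B,\mathcal C)$, $$\gamma(\psi\circ\phi_1,\psi\circ\phi_2)\le\gamma(\phi_1,\phi_2).$$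 -/

import Mathlib

open scoped CStarAlgebra ENNReal InnerProductSpace
open MulOpposite

universe u v w

/-! ### Adjointable operators on a Hilbert C⋆-module

Mathlib's `CStarModule R E` carries an `R`-valued inner product which is linear in its second
variable, with `⟪x, r • y⟫ = r * ⟪x, y⟫`.  A *right* Hilbert `B`-module is therefore a
`CStarModule Bᵐᵒᵖ E`: writing `y b` for `op b • y`, the element `unop ⟪x, y⟫` of `B` satisfies
`⟨x, y b⟩ = ⟨x, y⟩ b`, `⟨x, y⟩⋆ = ⟨y, x⟩` and `⟨x, x⟩ ≥ 0`. -/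

section Adjointable

variable (R : Type v) (E : Type w) [CStarAlgebra R] [PartialOrder R]
  [NormedAddCommGroup E] [NormedSpace ℂ E] [SMul R E] [CStarModule R E]

/-- The algebra `𝓑ᵃ(E)` of all bounded adjointable operators on a Hilbert C⋆-module `E`, with
composition as multiplication and with the operator norm. -/
def adjointable : Subalgebra ℂ (E →L[ℂ] E) where
  carrier := {T | ∃ S : E →L[ℂ] E, ∀ x y : E, ⟪T x, y⟫_R = ⟪x, S y⟫_R}
  mul_mem' := by
    rintro T₁ T₂ ⟨S₁, h₁⟩ ⟨S₂, h₂⟩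
    exact ⟨S₂ * S₁, fun x y => by simp [h₁, h₂]⟩
  add_mem' := by
    rintro T₁ T₂ ⟨S₁, h₁⟩ ⟨S₂, h₂⟩
    exact ⟨S₁ + S₂, fun x y => by simp [h₁, h₂]⟩
  algebraMap_mem' z :=
    ⟨algebraMap ℂ _ (star z), fun x y => by simp [Algebra.algebraMap_eq_smul_one]⟩

namespace adjointable

variable {R E}

/-- Elements of a Hilbert C⋆-module are determined by their inner products. -/
theorem ext_inner {y z : E} (h : ∀ x : E, ⟪x, y⟫_R = ⟪x, z⟫_R) : y = z := by
  rw [← sub_eq_zero, ← CStarModule.inner_self (A := R), CStarModule.inner_sub_right, h, sub_self]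

/-- The adjoint of an adjointable operator. -/
noncomputable def adj (T : adjointable R E) : adjointable R E :=
  ⟨T.2.choose, T.1, fun x y => by
    rw [← CStarModule.star_inner, ← T.2.choose_spec, CStarModule.star_inner]⟩

theorem inner_adj_right (T : adjointable R E) (x y : E) :
    ⟪x, (adj T).1 y⟫_R = ⟪T.1 x, y⟫_R := (T.2.choose_spec x y).symm

theorem inner_adj_left (T : adjointable R E) (x y : E) :
    ⟪(adj T).1 x, y⟫_R = ⟪x, T.1 y⟫_R := by
  rw [← CStarModule.star_inner, inner_adj_right, CStarModule.star_inner]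

/-- Two adjointable operators agree if all their matrix coefficients do. -/
theorem ext_of_inner {S T : adjointable R E}
    (h : ∀ x y : E, ⟪x, S.1 y⟫_R = ⟪x, T.1 y⟫_R) : S = T :=
  Subtype.ext <| ContinuousLinearMap.ext fun y => ext_inner (R := R) fun x => h x y

/-- Adjointable operators are automatically linear over the coefficient algebra. -/
theorem map_smul_coeff (T : adjointable R E) (r : R) (x : E) : T.1 (r • x) = r • T.1 x :=
  ext_inner (R := R) fun y => by
    rw [← inner_adj_left, CStarModule.inner_op_smul_right, CStarModule.inner_op_smul_right,
      inner_adj_left]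

noncomputable instance instStarRing : StarRing (adjointable R E) where
  star := adj
  star_involutive T := ext_of_inner fun x y => by rw [inner_adj_right, inner_adj_left]
  star_mul S T := ext_of_inner fun x y => by
    rw [inner_adj_right]
    change ⟪S.1 (T.1 x), y⟫_R = ⟪x, (adj T).1 ((adj S).1 y)⟫_R
    rw [inner_adj_right, inner_adj_right]
  star_add S T := ext_of_inner fun x y => by
    rw [inner_adj_right]
    change ⟪S.1 x + T.1 x, y⟫_R = ⟪x, (adj S).1 y + (adj T).1 y⟫_R
    rw [CStarModule.inner_add_left, CStarModule.inner_add_right, inner_adj_right, inner_adj_right]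

/-- The defining property of the adjoint. -/
theorem inner_star_right (T : adjointable R E) (x y : E) :
    ⟪x, (star T).1 y⟫_R = ⟪T.1 x, y⟫_R := inner_adj_right T x y

theorem inner_star_left (T : adjointable R E) (x y : E) :
    ⟪(star T).1 x, y⟫_R = ⟪x, T.1 y⟫_R := inner_adj_left T x y

instance instStarModule : StarModule ℂ (adjointable R E) where
  star_smul z T := ext_of_inner fun x y => by
    rw [inner_star_right]
    change ⟪z • T.1 x, y⟫_R = ⟪x, star z • (star T).1 y⟫_R
    rw [CStarModule.inner_smul_left_complex, CStarModule.inner_smul_right_complex,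
      inner_star_right]

variable [StarOrderedRing R]

instance instCStarRing : CStarRing (adjointable R E) where
  norm_mul_self_le T := by
    have h : ‖T.1‖ ≤ √‖star T * T‖ := by
      refine T.1.opNorm_le_bound (Real.sqrt_nonneg _) fun x => ?_
      refine le_of_sq_le_sq ?_ (by positivity)
      rw [mul_pow, Real.sq_sqrt (norm_nonneg (star T * T)), CStarModule.norm_sq_eq R, ← inner_star_right]
      calc ‖⟪x, (star T * T).1 x⟫_R‖ ≤ ‖x‖ * ‖(star T * T).1 x‖ := CStarModule.norm_inner_le E
        _ ≤ ‖x‖ * (‖(star T * T).1‖ * ‖x‖) := by gcongr; exact (star T * T).1.le_opNorm x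
        _ = ‖star T * T‖ * ‖x‖ ^ 2 := by
          change ‖x‖ * (‖star T * T‖ * ‖x‖) = _
          ring
    calc ‖T‖ * ‖T‖ ≤ √‖star T * T‖ * √‖star T * T‖ := mul_self_le_mul_self (norm_nonneg _) h
      _ = ‖star T * T‖ := Real.mul_self_sqrt (norm_nonneg _)

theorem isClosed [CompleteSpace E] : IsClosed (adjointable R E : Set (E →L[ℂ] E)) := by
  refine IsSeqClosed.isClosed fun T T₀ hT hlim => ?_
  let T' : ℕ → adjointable R E := fun n => ⟨T n, hT n⟩
  have hC : CauchySeq fun n => (star (T' n)).1 := by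
    rw [Metric.cauchySeq_iff']
    intro ε hε
    obtain ⟨N, hN⟩ := Metric.cauchySeq_iff'.1 hlim.cauchySeq ε hε
    refine ⟨N, fun n hn => ?_⟩
    have : dist (star (T' n)).1 (star (T' N)).1 = dist (T n) (T N) := by
      rw [dist_eq_norm, dist_eq_norm]
      change ‖star (T' n) - star (T' N)‖ = ‖T' n - T' N‖
      rw [← star_sub]
      exact norm_star (T' n - T' N)
    rw [this]
    exact hN n hn
  obtain ⟨S, hS⟩ := cauchySeq_tendsto_of_complete hC
  refine ⟨S, fun x y => ?_⟩
  have h₁ : Filter.Tendsto (fun n => ⟪T n x, y⟫_R) Filter.atTop (nhds ⟪T₀ x, y⟫_R) :=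
    (CStarModule.continuous_inner.tendsto (T₀ x, y)).comp
      (((ContinuousLinearMap.apply ℂ E x).continuous.tendsto T₀ |>.comp hlim).prodMk_nhds
        tendsto_const_nhds)
  have h₂ : Filter.Tendsto (fun n => ⟪x, (star (T' n)).1 y⟫_R) Filter.atTop (nhds ⟪x, S y⟫_R) :=
    (CStarModule.continuous_inner.tendsto (x, S y)).comp
      (tendsto_const_nhds.prodMk_nhds
        ((ContinuousLinearMap.apply ℂ E y).continuous.tendsto S |>.comp hS))
  refine tendsto_nhds_unique h₁ (h₂.congr fun n => ?_)
  exact inner_star_right (T' n) x y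

instance instCompleteSpace [CompleteSpace E] : CompleteSpace (adjointable R E) :=
  isClosed.isComplete.completeSpace_coe

/-- The adjointable operators on a Hilbert C⋆-module form a unital C⋆-algebra. -/
noncomputable instance instCStarAlgebra [CompleteSpace E] : CStarAlgebra (adjointable R E) where

noncomputable instance instPartialOrder [CompleteSpace E] : PartialOrder (adjointable R E) :=
  CStarAlgebra.spectralOrder _

instance instStarOrderedRing [CompleteSpace E] : StarOrderedRing (adjointable R E) :=
  CStarAlgebra.spectralOrderedRing _

end adjointable

end Adjointable

/-! ### The completely bounded norm -/

/-- The completely bounded norm `‖f‖_cb = sup_n ‖f⁽ⁿ⁾‖ ∈ [0, ∞]` of a linear map between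
C⋆-algebras, where `f⁽ⁿ⁾ : Mₙ(A) → Mₙ(D)` applies `f` to every entry and the matrix algebras carry
their C⋆-norms. -/
noncomputable def cbNorm {A : Type u} {D : Type v}
    [CStarAlgebra A] [PartialOrder A] [StarOrderedRing A]
    [CStarAlgebra D] [PartialOrder D] [StarOrderedRing D] (f : A →ₗ[ℂ] D) : ℝ≥0∞ :=
  ⨆ (n : ℕ) (M : CStarMatrix (Fin n) (Fin n) A) (_ : ‖M‖ ≤ 1), ENNReal.ofReal ‖M.map f‖

/-! ### Unital completely positive maps -/

/-- Unital completely positive maps between unital C⋆-algebras. -/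
structure UCP (A : Type u) (B : Type v)
    [CStarAlgebra A] [PartialOrder A] [StarOrderedRing A]
    [CStarAlgebra B] [PartialOrder B] [StarOrderedRing B]
    extends CompletelyPositiveMap A B where
  map_one' : toFun 1 = 1

namespace UCP

variable {A : Type u} {B : Type v} {C : Type w}
  [CStarAlgebra A] [PartialOrder A] [StarOrderedRing A]
  [CStarAlgebra B] [PartialOrder B] [StarOrderedRing B]
  [CStarAlgebra C] [PartialOrder C] [StarOrderedRing C]

instance : CoeFun (UCP A B) (fun _ => A → B) where
  coe φ := φ.toFun

/-- The composition `ψ ∘ φ` of unital completely positive maps. -/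
noncomputable def comp (ψ : UCP B C) (φ : UCP A B) : UCP A C where
  toLinearMap := ψ.toLinearMap ∘ₗ φ.toLinearMap
  map_cstarMatrix_nonneg' k M hM :=
    ψ.map_cstarMatrix_nonneg' k _ (φ.map_cstarMatrix_nonneg' k M hM)
  map_one' := (congrArg ψ.toFun φ.map_one').trans ψ.map_one'

theorem comp_apply (ψ : UCP B C) (φ : UCP A B) (a : A) : ψ.comp φ a = ψ (φ a) := rfl

end UCP

/-! ### The representation distance -/

section RepresentationDistance

variable {A : Type u} {B : Type v}
  [CStarAlgebra A] [PartialOrder A] [StarOrderedRing A]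
  [CStarAlgebra B] [PartialOrder B] [StarOrderedRing B]

/-- A joint representation tuple `(E, σ₁, σ₂, x)` of `(φ₁, φ₂)`: a (right) Hilbert `B`-module `E`
with two unital left actions `σ₁, σ₂` of `A` by adjointable operators and a unit vector `x` such
that `φᵢ(a) = ⟨x, σᵢ(a) x⟩`. -/
structure JointRepresentation (φ₁ φ₂ : UCP A B) where
  E : Type (max u v)
  [instNormedAddCommGroup : NormedAddCommGroup E]
  [instNormedSpace : NormedSpace ℂ E]
  [instCompleteSpace : CompleteSpace E]
  [instModule : Module Bᵐᵒᵖ E]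
  [instCStarModule : CStarModule Bᵐᵒᵖ E]
  σ₁ : A →⋆ₐ[ℂ] adjointable Bᵐᵒᵖ E
  σ₂ : A →⋆ₐ[ℂ] adjointable Bᵐᵒᵖ E
  x : E
  inner_self_eq_one : unop ⟪x, x⟫_Bᵐᵒᵖ = 1
  inner_left : ∀ a : A, φ₁ a = unop ⟪x, (σ₁ a).1 x⟫_Bᵐᵒᵖ
  inner_right : ∀ a : A, φ₂ a = unop ⟪x, (σ₂ a).1 x⟫_Bᵐᵒᵖ

attribute [instance] JointRepresentation.instNormedAddCommGroup
  JointRepresentation.instNormedSpace JointRepresentation.instCompleteSpace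
  JointRepresentation.instModule JointRepresentation.instCStarModule

/-- `‖σ₁ - σ₂‖_cb` for a joint representation tuple, the difference being regarded as a linear map
from `A` to the C⋆-algebra `𝓑ᵃ(E)`. -/
noncomputable def JointRepresentation.cbDist {φ₁ φ₂ : UCP A B}
    (T : JointRepresentation φ₁ φ₂) : ℝ≥0∞ :=
  cbNorm (T.σ₁.toAlgHom.toLinearMap - T.σ₂.toAlgHom.toLinearMap)

/-- The representation distance `γ(φ₁, φ₂) = inf ‖σ₁ - σ₂‖_cb`, the infimum being taken over all
joint representation tuples of `(φ₁, φ₂)`. -/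
noncomputable def repDist (φ₁ φ₂ : UCP A B) : ℝ≥0∞ :=
  ⨅ T : JointRepresentation φ₁ φ₂, T.cbDist

end RepresentationDistance

/-! ### Positivity of matrices over a C⋆-algebra -/

/-! A joint representation can be induced along `ψ`. Given `(E, σ₁, σ₂, x)` for `(φ₁, φ₂)`, form the
Hilbert `C`-module `E ⊗_ψ C` by completing the formal sums of symbols `e ⊗ c` for `⟨e ⊗ c, e' ⊗ c'⟩
= c⋆ ψ(⟨e, e'⟩) c'`. Since `π : T ↦ T ⊗ 1` is a unital ⋆-homomorphism, `π ∘ σ₁`, `π ∘ σ₂` and `x ⊗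
1` represent `ψ ∘ φ₁` and `ψ ∘ φ₂`. The new difference is `π ∘ (σ₁ - σ₂)`, and ⋆-homomorphisms are
completely contractive, so its cb norm has not grown; take infima.

Two positivity facts carry the construction. The form is semidefinite because Gram matrices in a
Hilbert module are positive and `ψ` is completely positive (`CStarModule.gram_nonneg`,
`kernelForm_kernel_self_nonneg`). The operator `T ⊗ 1` is bounded by `‖T‖` because `‖T‖² - T⋆T` has
the form `S⋆S` (`norm_map_le`).

The formal sums live on the bare set `E`, with no tensor relations imposed. These relations hold up
to null vectors, which the separated completion kills; so linearity in `T` is checked inside inner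
products. -/

theorem CStarAlgebra.exists_eq_star_mul_self {D : Type*} [CStarAlgebra D] [PartialOrder D]
    [StarOrderedRing D] {a : D} (ha : 0 ≤ a) : ∃ b : D, a = star b * b :=
  CStarAlgebra.nonneg_iff_eq_star_mul_self.1 ha

/-- A selfadjoint element `a` is positive as soon as the element `-(star t * t)`, obtained by
compressing `a` to its negative part, vanishes. -/
theorem CStarAlgebra.exists_compression_eq_neg_star_mul_self {D : Type*} [CStarAlgebra D]
    [PartialOrder D] [StarOrderedRing D] {a : D} (ha : IsSelfAdjoint a) :
    ∃ s t : D, star s * a * s = -(star t * t) ∧ (t = 0 → 0 ≤ a) := by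
  have hs : 0 ≤ a⁻ := CFC.negPart_nonneg a
  have hss : star a⁻ = a⁻ := (IsSelfAdjoint.of_nonneg hs).star_eq
  obtain ⟨q, hq⟩ := CStarAlgebra.nonneg_iff_eq_star_mul_self.1 hs
  refine ⟨a⁻, q * a⁻, ?_, fun h => ?_⟩
  -- Compressing by `s = a⁻` gives `-(a⁻)³`, and `a⁻ = q⋆q` makes this `-(q a⁻)⋆(q a⁻)`, whence `t =
  -- q a⁻`.
  · have h1 : a⁻ * a = -(a⁻ * a⁻) := by
      conv_lhs =>
        enter [2]
        rw [← CFC.posPart_sub_negPart a ha]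
      rw [mul_sub, CFC.negPart_mul_posPart, zero_sub]
    have h2 : star (q * a⁻) * (q * a⁻) = a⁻ * a⁻ * a⁻ := by
      rw [star_mul, hss, mul_assoc, ← mul_assoc (star q), ← hq, mul_assoc]
    rw [hss, h1, h2, neg_mul]
  · have h3 : a⁻ * a⁻ = 0 := by
      have : a⁻ * a⁻ = star q * (q * a⁻) := by rw [← mul_assoc, ← hq]
      rw [this, h, mul_zero]
    have h4 : a⁻ = 0 := by
      rw [← CStarRing.star_mul_self_eq_zero_iff, hss, h3]
    rw [← CFC.posPart_sub_negPart a ha, h4, sub_zero]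
    exact CFC.posPart_nonneg a

namespace CStarMatrix

variable {A : Type*} [CStarAlgebra A] [PartialOrder A] [StarOrderedRing A]
  {n : Type*} [Fintype n]

/-- With `M = N⋆N` the form becomes the sum of squares `∑ₖ (Nv)ₖ⋆ (Nv)ₖ`. -/
theorem sum_star_mul_mul_nonneg {M : CStarMatrix n n A} (hM : 0 ≤ M) (v : n → A) :
    0 ≤ ∑ i, ∑ j, star (v i) * M i j * v j := by
  classical
  obtain ⟨N, rfl⟩ := CStarAlgebra.exists_eq_star_mul_self hM
  have h : ∑ i, ∑ j, star (v i) * (star N * N) i j * v j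
      = ∑ k, star (∑ i, N k i * v i) * ∑ j, N k j * v j := by
    simp only [mul_apply, star_apply, star_sum, Finset.sum_mul, Finset.mul_sum, star_mul]
    rw [Finset.sum_comm]
    conv_rhs => rw [Finset.sum_comm]
    refine Finset.sum_congr rfl fun j _ => ?_
    rw [Finset.sum_comm]
    simp only [mul_assoc]
  rw [h]
  exact Finset.sum_nonneg fun k _ => star_mul_self_nonneg _

/-- Compress `M` to its negative part: `S⋆MS = -N⋆N`. The `k`-th diagonal entry is the form at the
`k`-th column of `S`, hence nonnegative, yet it equals `-∑ᵢ Nᵢₖ⋆Nᵢₖ`. So every entry of `N`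
vanishes. -/
theorem nonneg_of_sum_star_mul_mul_nonneg {M : CStarMatrix n n A} (hM : IsSelfAdjoint M)
    (h : ∀ v : n → A, 0 ≤ ∑ i, ∑ j, star (v i) * M i j * v j) : 0 ≤ M := by
  classical
  obtain ⟨S, N, key, hN⟩ := CStarAlgebra.exists_compression_eq_neg_star_mul_self hM
  refine hN ?_
  ext i k
  have h0 := h fun i => S i k
  have h1 : ∑ i, ∑ j, star (S i k) * M i j * S j k = (star S * M * S) k k := by
    simp only [mul_apply, star_apply, Finset.sum_mul]
    rw [Finset.sum_comm]
  rw [h1, key, neg_apply, mul_apply, neg_nonneg] at h0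
  simp only [star_apply] at h0
  have h2 := (Finset.sum_eq_zero_iff_of_nonneg
    (fun i _ => star_mul_self_nonneg (N i k))).1
      (le_antisymm h0 (Finset.sum_nonneg fun i _ => star_mul_self_nonneg _)) i (Finset.mem_univ i)
  exact (CStarRing.star_mul_self_eq_zero_iff _).1 h2

end CStarMatrix

/-- Evaluated at `v`, the form of the Gram matrix is `⟨y, y⟩` with `y = ∑ eᵢ vᵢ`. -/
theorem CStarModule.gram_nonneg {B : Type*} [CStarAlgebra B] [PartialOrder B] [StarOrderedRing B]
    {E : Type*} [NormedAddCommGroup E] [NormedSpace ℂ E] [Module Bᵐᵒᵖ E] [CStarModule Bᵐᵒᵖ E]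
    {n : Type*} [Fintype n] (e : n → E) :
    0 ≤ CStarMatrix.ofMatrix (Matrix.of fun i j => unop ⟪e i, e j⟫_Bᵐᵒᵖ) := by
  refine CStarMatrix.nonneg_of_sum_star_mul_mul_nonneg ?_ fun v => ?_
  · ext i j
    rw [CStarMatrix.star_apply]
    change star (unop ⟪e j, e i⟫_Bᵐᵒᵖ) = unop ⟪e i, e j⟫_Bᵐᵒᵖ
    rw [← unop_star, CStarModule.star_inner]
  · have h := CStarModule.inner_self_nonneg (A := Bᵐᵒᵖ) (x := ∑ i, op (v i) • e i)
    rw [← unop_nonneg] at h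
    simp only [CStarModule.inner_sum_left, CStarModule.inner_sum_right,
      CStarModule.inner_op_smul_left, CStarModule.inner_op_smul_right, Finset.unop_sum, unop_mul,
      unop_star, unop_op] at h
    convert h using 1
    rw [Finset.sum_comm]
    simp only [Finset.sum_mul]
    rfl

/-! ### Semidefinite Hilbert C⋆-modules and their completions -/

/-- A `CStarModule` whose inner product is only positive semidefinite. -/
class PreCStarModule (R V : Type*) [NonUnitalSemiring R] [StarRing R] [Module ℂ R]
    [AddCommGroup V] [Module ℂ V] [PartialOrder R] [SMul R V] [Norm R] [Norm V]
    extends Inner R V where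
  inner_add_right (x y z : V) : inner x (y + z) = inner x y + inner x z
  inner_self_nonneg (x : V) : 0 ≤ inner x x
  inner_op_smul_right (a : R) (x y : V) : inner x (a • y) = a * inner x y
  inner_smul_right_complex (z : ℂ) (x y : V) : inner x (z • y) = z • inner x y
  star_inner (x y : V) : star (inner x y) = inner y x
  norm_eq_sqrt_norm_inner_self (x : V) : ‖x‖ = √‖inner x x‖

namespace PreCStarModule

/-! ### Cauchy–Schwarz and the seminorm of a semidefinite inner product -/

section Norm

variable {R V : Type*} [CStarAlgebra R] [PartialOrder R]
  [AddCommGroup V] [Module ℂ V] [SMul R V] [Norm V] [PreCStarModule R V]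

theorem inner_add_left (x y z : V) : ⟪x + y, z⟫_R = ⟪x, z⟫_R + ⟪y, z⟫_R := by
  rw [← star_inner, inner_add_right, star_add, star_inner, star_inner]

theorem inner_op_smul_left (a : R) (x y : V) : ⟪a • x, y⟫_R = ⟪x, y⟫_R * star a := by
  rw [← star_inner, inner_op_smul_right, star_mul, star_inner]

theorem inner_smul_left_complex (z : ℂ) (x y : V) : ⟪z • x, y⟫_R = star z • ⟪x, y⟫_R := by
  rw [← star_inner, inner_smul_right_complex, star_smul, star_inner]

theorem norm_sq_eq (x : V) : ‖x‖ ^ 2 = ‖⟪x, x⟫_R‖ := by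
  rw [norm_eq_sqrt_norm_inner_self (R := R), Real.sq_sqrt (norm_nonneg _)]

theorem norm_nonneg' (R : Type*) {V : Type*} [CStarAlgebra R] [PartialOrder R]
    [AddCommGroup V] [Module ℂ V] [SMul R V] [Norm V] [PreCStarModule R V] (x : V) : 0 ≤ ‖x‖ := by
  rw [norm_eq_sqrt_norm_inner_self (R := R)]
  positivity

variable (R V) in
/-- The inner product as a biadditive map. -/
def innerAddHom : V →+ V →+ R :=
  AddMonoidHom.mk' (fun x => AddMonoidHom.mk' (fun y => ⟪x, y⟫_R) (inner_add_right x))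
    fun x y => AddMonoidHom.ext (inner_add_left x y)

theorem innerAddHom_apply (x y : V) : innerAddHom R V x y = ⟪x, y⟫_R := rfl

theorem inner_sub_right (x y z : V) : ⟪x, y - z⟫_R = ⟪x, y⟫_R - ⟪x, z⟫_R :=
  map_sub (innerAddHom R V x) y z

theorem inner_sub_left (x y z : V) : ⟪x - y, z⟫_R = ⟪x, z⟫_R - ⟪y, z⟫_R := by
  simp only [← innerAddHom_apply, map_sub, AddMonoidHom.sub_apply]

theorem norm_smul_complex (R : Type*) {V : Type*} [CStarAlgebra R] [PartialOrder R]
    [AddCommGroup V] [Module ℂ V] [SMul R V] [Norm V] [PreCStarModule R V] (z : ℂ) (x : V) : ‖z • x‖ = ‖z‖ * ‖x‖ := by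
  have h : ‖z • x‖ ^ 2 = (‖z‖ * ‖x‖) ^ 2 := by
    rw [mul_pow, norm_sq_eq (R := R) (z • x), norm_sq_eq (R := R) x, inner_smul_right_complex,
      inner_smul_left_complex, norm_smul, norm_smul, norm_star, sq, mul_assoc]
  exact (sq_eq_sq₀ (norm_nonneg' R _) (mul_nonneg (norm_nonneg _) (norm_nonneg' R _))).1 h

theorem norm_smul_coeff_le (a : R) (x : V) : ‖a • x‖ ≤ ‖a‖ * ‖x‖ := by
  refine le_of_sq_le_sq ?_ (mul_nonneg (norm_nonneg _) (norm_nonneg' R _))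
  rw [mul_pow, norm_sq_eq (R := R) (a • x), norm_sq_eq (R := R) x, inner_op_smul_right, inner_op_smul_left]
  calc ‖a * (⟪x, x⟫_R * star a)‖ ≤ ‖a‖ * (‖⟪x, x⟫_R‖ * ‖star a‖) :=
        (norm_mul_le _ _).trans (by gcongr; exact norm_mul_le _ _)
    _ = ‖a‖ ^ 2 * ‖⟪x, x⟫_R‖ := by rw [norm_star]; ring

variable [StarOrderedRing R]

/-- Expand `0 ≤ ⟨ax - sy, ax - sy⟩` with `a = ⟨x, y⟩` and bound `a⟨x, x⟩a⋆` by `s aa⋆`. The strict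
inequality keeps `s` positive, so that one may divide by it even when `‖x‖ = 0`. -/
theorem inner_mul_inner_swap_le_of_lt {x y : V} {s : ℝ} (hs : ‖x‖ ^ 2 < s) :
    ⟪x, y⟫_R * ⟪y, x⟫_R ≤ s • ⟪y, y⟫_R := by
  have hs0 : 0 < s := (sq_nonneg _).trans_lt hs
  set a := ⟪x, y⟫_R with ha
  have hstar : star a = ⟪y, x⟫_R := star_inner x y
  have h1 : a * ⟪x, x⟫_R * star a ≤ s • (a * star a) :=
    (CStarAlgebra.star_right_conjugate_le_norm_smul (b := ⟪x, x⟫_R)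
      (hb := isSelfAdjoint_iff.2 (star_inner x x))).trans <| by
      rw [← norm_sq_eq]
      exact smul_le_smul_of_nonneg_right hs.le (mul_star_self_nonneg a)
  have h0 : 0 ≤ ⟪a • x - (s : ℂ) • y, a • x - (s : ℂ) • y⟫_R := inner_self_nonneg _
  have h2 : ⟪a • x - (s : ℂ) • y, a • x - (s : ℂ) • y⟫_R
      = a * ⟪x, x⟫_R * star a - s • (a * star a) - s • (a * star a) + s • (s • ⟪y, y⟫_R) := by
    rw [inner_sub_right, inner_sub_left, inner_sub_left]
    simp only [inner_op_smul_right, inner_op_smul_left, inner_smul_right_complex,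
      inner_smul_left_complex, ← hstar, ← ha, RCLike.star_def, Complex.conj_ofReal]
    simp only [Complex.coe_smul, mul_smul_comm, mul_assoc]
    abel
  rw [h2] at h0
  have h3 : 0 ≤ s • (s • ⟪y, y⟫_R - a * star a) := by
    refine h0.trans ?_
    rw [smul_sub]
    have := sub_nonneg.2 h1
    rw [← sub_nonneg]
    convert this using 1
    abel
  rw [← hstar, ← sub_nonneg]
  simpa only [inv_smul_smul₀ hs0.ne'] using smul_nonneg (inv_nonneg.2 hs0.le) h3

variable (R) in
theorem norm_inner_le (x y : V) : ‖⟪x, y⟫_R‖ ≤ ‖x‖ * ‖y‖ := by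
  refine le_of_sq_le_sq ?_ (mul_nonneg (norm_nonneg' R _) (norm_nonneg' R _))
  rw [mul_pow]
  have h : ∀ s : ℝ, ‖x‖ ^ 2 < s → ‖⟪x, y⟫_R‖ ^ 2 ≤ s * ‖y‖ ^ 2 := fun s hs => by
    have hs0 : 0 < s := (sq_nonneg _).trans_lt hs
    calc ‖⟪x, y⟫_R‖ ^ 2 = ‖⟪x, y⟫_R * ⟪y, x⟫_R‖ := by
          rw [← star_inner x y, CStarRing.norm_self_mul_star, sq]
      _ ≤ ‖s • ⟪y, y⟫_R‖ := by
          refine CStarAlgebra.norm_le_norm_of_nonneg_of_le ?_ (inner_mul_inner_swap_le_of_lt hs)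
          rw [← star_inner x y]
          exact mul_star_self_nonneg _
      _ = s * ‖y‖ ^ 2 := by
          rw [norm_smul, Real.norm_of_nonneg hs0.le, norm_sq_eq (R := R)]
  -- Let `s` decrease to `‖x‖²`.
  have hlim : Filter.Tendsto (fun s : ℝ => s * ‖y‖ ^ 2) (nhdsWithin (‖x‖ ^ 2) (Set.Ioi (‖x‖ ^ 2)))
      (nhds (‖x‖ ^ 2 * ‖y‖ ^ 2)) :=
    ((continuous_id.mul continuous_const).tendsto (‖x‖ ^ 2)).mono_left nhdsWithin_le_nhds
  exact ge_of_tendsto hlim (Filter.eventually_of_mem self_mem_nhdsWithin h)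

theorem norm_triangle (R : Type*) {V : Type*} [CStarAlgebra R] [PartialOrder R] [StarOrderedRing R]
    [AddCommGroup V] [Module ℂ V] [SMul R V] [Norm V] [PreCStarModule R V]
    (x y : V) : ‖x + y‖ ≤ ‖x‖ + ‖y‖ := by
  refine le_of_sq_le_sq ?_ (add_nonneg (norm_nonneg' R _) (norm_nonneg' R _))
  calc ‖x + y‖ ^ 2 = ‖⟪x, x⟫_R + ⟪y, x⟫_R + (⟪x, y⟫_R + ⟪y, y⟫_R)‖ := by
        rw [norm_sq_eq (R := R), inner_add_right, inner_add_left, inner_add_left]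
    _ ≤ (‖⟪x, x⟫_R‖ + ‖⟪y, x⟫_R‖) + (‖⟪x, y⟫_R‖ + ‖⟪y, y⟫_R‖) :=
        (norm_add_le _ _).trans (add_le_add (norm_add_le _ _) (norm_add_le _ _))
    _ ≤ (‖x‖ ^ 2 + ‖y‖ * ‖x‖) + (‖x‖ * ‖y‖ + ‖y‖ ^ 2) := by
        rw [norm_sq_eq (R := R), norm_sq_eq (R := R)]
        gcongr <;> exact norm_inner_le R _ _
    _ = (‖x‖ + ‖y‖) ^ 2 := by ring

theorem seminormedSpaceCore (R V : Type*) [CStarAlgebra R] [PartialOrder R] [StarOrderedRing R]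
    [AddCommGroup V] [Module ℂ V] [SMul R V] [Norm V] [PreCStarModule R V] :
    SeminormedSpace.Core ℂ V where
  norm_nonneg := norm_nonneg' R
  norm_smul := norm_smul_complex R
  norm_triangle := norm_triangle R

end Norm

/-! ### Extending the inner product to the completion -/

section Completion

open UniformSpace

variable {R V : Type*} [CStarAlgebra R] [PartialOrder R] [StarOrderedRing R]
  [SeminormedAddCommGroup V] [NormedSpace ℂ V] [Module R V] [PreCStarModule R V]

theorem uniformContinuousConstSMul (R V : Type*) [CStarAlgebra R] [PartialOrder R]
    [SeminormedAddCommGroup V] [NormedSpace ℂ V] [Module R V] [PreCStarModule R V] :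
    UniformContinuousConstSMul R V :=
  ⟨fun a => uniformContinuous_of_continuousAt_zero (DistribSMul.toAddMonoidHom V a) <|
    (AddMonoidHomClass.continuous_of_bound (DistribSMul.toAddMonoidHom V a) ‖a‖
      fun x => norm_smul_coeff_le a x).continuousAt⟩

theorem continuous_inner : Continuous fun p : V × V => ⟪p.1, p.2⟫_R := by
  let f : V →ₗ⋆[ℂ] V →ₗ[ℂ] R := LinearMap.mk₂'ₛₗ (starRingEnd ℂ) (RingHom.id ℂ)
    (fun x y => ⟪x, y⟫_R) inner_add_left inner_smul_left_complex inner_add_right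
    inner_smul_right_complex
  let F := f.mkContinuous₂ 1 fun x y => by
    rw [one_mul]
    exact norm_inner_le R x y
  exact (F.continuous.comp continuous_fst).clm_apply continuous_snd

theorem inner_coe (x y : V) : ⟪(x : Completion V), (y : Completion V)⟫_R = ⟪x, y⟫_R :=
  (Completion.isDenseInducing_coe.prodMap Completion.isDenseInducing_coe).extend_eq
    (continuous_inner : Continuous (Function.uncurry (inner R))) (x, y)

/-- The inner product need not be uniformly continuous on pairs; continuity of the extension comes
from biadditivity. -/
theorem continuous_inner_completion :
    Continuous fun p : Completion V × Completion V => ⟪p.1, p.2⟫_R := by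
  have h : Continuous fun p : V × V => innerAddHom R V p.1 p.2 := continuous_inner
  exact ((Completion.isDenseInducing_toCompl V).extend_Z_bilin (Completion.isDenseInducing_toCompl V) h)

theorem norm_sq_eq_completion (x : Completion V) : ‖x‖ ^ 2 = ‖⟪x, x⟫_R‖ :=
  Completion.induction_on x
    (isClosed_eq (continuous_norm.pow 2)
      (continuous_inner_completion.comp (continuous_id.prodMk continuous_id)).norm)
    fun a => by rw [inner_coe, Completion.norm_coe, norm_sq_eq (R := R)]

variable [UniformContinuousConstSMul R V]

noncomputable instance instCStarModuleCompletion : CStarModule R (Completion V) where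
  inner_add_right {x y z} := Completion.induction_on₃ x y z
    (isClosed_eq
      (continuous_inner_completion.comp (continuous_fst.prodMk
        ((continuous_fst.comp continuous_snd).add (continuous_snd.comp continuous_snd))))
      ((continuous_inner_completion.comp (continuous_fst.prodMk
          (continuous_fst.comp continuous_snd))).add
        (continuous_inner_completion.comp (continuous_fst.prodMk
          (continuous_snd.comp continuous_snd)))))
    fun a b c => by simp only [← Completion.coe_add, inner_coe, inner_add_right]
  inner_self_nonneg {x} := Completion.induction_on x
    (isClosed_Ici.preimage (continuous_inner_completion.comp (continuous_id.prodMk continuous_id)))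
    fun a => by
      rw [inner_coe]
      exact inner_self_nonneg a
  -- Definiteness is gained here: the completion is separated, so a vector of norm zero is zero.
  inner_self {x} := by
    rw [← norm_eq_zero (a := ⟪x, x⟫_R), ← norm_sq_eq_completion, sq_eq_zero_iff, norm_eq_zero]
  inner_op_smul_right {a x y} := Completion.induction_on₂ x y
    (isClosed_eq
      (continuous_inner_completion.comp (continuous_fst.prodMk (continuous_snd.const_smul a)))
      (continuous_const.mul continuous_inner_completion))
    fun b c => by rw [← Completion.coe_smul, inner_coe, inner_coe, inner_op_smul_right]
  inner_smul_right_complex {z x y} := Completion.induction_on₂ x y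
    (isClosed_eq
      (continuous_inner_completion.comp (continuous_fst.prodMk (continuous_snd.const_smul z)))
      (continuous_inner_completion.const_smul z))
    fun b c => by rw [← Completion.coe_smul, inner_coe, inner_coe, inner_smul_right_complex]
  star_inner x y := Completion.induction_on₂ x y
    (isClosed_eq (continuous_star.comp continuous_inner_completion)
      (continuous_inner_completion.comp (continuous_snd.prodMk continuous_fst)))
    fun b c => by rw [inner_coe, inner_coe, star_inner]
  norm_eq_sqrt_norm_inner_self x := by
    rw [← norm_sq_eq_completion, Real.sqrt_sq (norm_nonneg x)]

end Completion

end PreCStarModule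

/-! ### Sesquilinear forms given by a kernel -/

section KernelForm

variable {X C : Type*} [CStarAlgebra C]

/-- The `C`-valued form `⟨f, g⟩ = ∑ (f x)⋆ k(x, y) g y` on finitely supported functions. -/
noncomputable def kernelForm (k : X → X → C) (f g : X →₀ C) : C :=
  g.sum fun y d => f.sum fun x c => star c * k x y * d

theorem kernelForm_add_right (k : X → X → C) (f g h : X →₀ C) :
    kernelForm k f (g + h) = kernelForm k f g + kernelForm k f h :=
  Finsupp.sum_add_index' (fun y => by simp) fun y c d => by
    simp only [mul_add, Finsupp.sum_add]

theorem kernelForm_smul_right (k : X → X → C) (f g : X →₀ C) (z : ℂ) :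
    kernelForm k f (z • g) = z • kernelForm k f g := by
  rw [kernelForm, Finsupp.sum_smul_index' fun y => by simp, kernelForm, Finsupp.smul_sum]
  simp only [mul_smul_comm, Finsupp.smul_sum]

theorem kernelForm_op_smul_right (k : X → X → C) (f g : X →₀ C) (a : Cᵐᵒᵖ) :
    kernelForm k f (a • g) = kernelForm k f g * unop a := by
  rw [kernelForm, Finsupp.sum_smul_index' fun y => by simp, kernelForm, Finsupp.sum_mul]
  simp only [Finsupp.sum_mul, mul_assoc, smul_eq_mul_unop]

theorem star_kernelForm {k : X → X → C} (hk : ∀ x y, star (k x y) = k y x) (f g : X →₀ C) :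
    star (kernelForm k f g) = kernelForm k g f := by
  simp only [kernelForm, Finsupp.sum, star_sum, star_mul, star_star, hk, mul_assoc]
  rw [Finset.sum_comm]

theorem kernelForm_mapDomain_right (k : X → X → C) (T : X → X) (f g : X →₀ C) :
    kernelForm k f (g.mapDomain T) = kernelForm (fun x y => k x (T y)) f g :=
  Finsupp.sum_mapDomain_index (fun y => by simp) fun y c d => by
    simp only [mul_add, Finsupp.sum_add]

theorem kernelForm_mapDomain_left (k : X → X → C) (T : X → X) (f g : X →₀ C) :
    kernelForm k (f.mapDomain T) g = kernelForm (fun x y => k (T x) y) f g := by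
  refine Finsupp.sum_congr fun y _ => ?_
  exact Finsupp.sum_mapDomain_index (fun x => by simp) fun x c d => by
    simp only [star_add, add_mul]

theorem kernelForm_add (k l : X → X → C) (f g : X →₀ C) :
    kernelForm (fun x y => k x y + l x y) f g = kernelForm k f g + kernelForm l f g := by
  simp only [kernelForm, mul_add, add_mul, Finsupp.sum_add]

theorem kernelForm_smul (z : ℂ) (k : X → X → C) (f g : X →₀ C) :
    kernelForm (fun x y => z • k x y) f g = z • kernelForm k f g := by
  simp only [kernelForm, mul_smul_comm, smul_mul_assoc, Finsupp.smul_sum]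

theorem kernelForm_single (k : X → X → C) (x y : X) (c d : C) :
    kernelForm k (Finsupp.single x c) (Finsupp.single y d) = star c * k x y * d := by
  rw [kernelForm, Finsupp.sum_single_index (by simp), Finsupp.sum_single_index (by simp)]

theorem kernelForm_self_nonneg [PartialOrder C] [StarOrderedRing C] {k : X → X → C}
    (f : X →₀ C)
    (hk : 0 ≤ CStarMatrix.ofMatrix (Matrix.of fun x y : f.support => k x y)) :
    0 ≤ kernelForm k f f := by
  have h := CStarMatrix.sum_star_mul_mul_nonneg hk fun x => f x
  rw [Finset.sum_comm] at h
  convert h using 1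
  rw [kernelForm, Finsupp.sum, ← Finset.sum_coe_sort]
  refine Finset.sum_congr rfl fun x _ => ?_
  rw [Finsupp.sum, ← Finset.sum_coe_sort]
  rfl

end KernelForm

/-! ### The interior tensor product along a completely positive map -/

section InteriorTensor

variable {B C : Type*}
  [CStarAlgebra B] [PartialOrder B] [StarOrderedRing B]
  [CStarAlgebra C] [PartialOrder C] [StarOrderedRing C]
  (ψ : B →CP C) (E : Type*) [NormedAddCommGroup E] [NormedSpace ℂ E]
  [Module Bᵐᵒᵖ E] [CStarModule Bᵐᵒᵖ E]

theorem CompletelyPositiveMap.map_star' (b : B) : ψ (star b) = star (ψ b) := map_star ψ b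

/-- Finitely supported functions `E → C`, thought of as formal sums `∑ eᵢ ⊗ cᵢ`, equipped with the
semi-inner product `⟨e ⊗ c, e' ⊗ c'⟩ = c⋆ ψ(⟨e, e'⟩) c'`. -/
def PreInteriorTensor (_ψ : B →CP C) (E : Type*) [NormedAddCommGroup E] [NormedSpace ℂ E]
    [Module Bᵐᵒᵖ E] [CStarModule Bᵐᵒᵖ E] : Type _ := E →₀ C

namespace PreInteriorTensor

noncomputable instance : AddCommGroup (PreInteriorTensor ψ E) :=
  inferInstanceAs <| AddCommGroup (E →₀ C)

noncomputable instance : Module ℂ (PreInteriorTensor ψ E) :=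
  inferInstanceAs <| Module ℂ (E →₀ C)

noncomputable instance : Module Cᵐᵒᵖ (PreInteriorTensor ψ E) :=
  inferInstanceAs <| Module Cᵐᵒᵖ (E →₀ C)

variable {E} in
/-- The kernel `ψ(⟨e, e'⟩)`. -/
noncomputable def kernel (x y : E) : C := ψ (unop ⟪x, y⟫_Bᵐᵒᵖ)

noncomputable instance : Norm (PreInteriorTensor ψ E) :=
  ⟨fun f => √‖op (kernelForm (kernel ψ) f f)‖⟩

variable {ψ E}

theorem star_kernel (x y : E) : star (kernel ψ x y) = kernel ψ y x := by
  rw [kernel, ← CompletelyPositiveMap.map_star', ← unop_star, CStarModule.star_inner, kernel]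

/-- Complete positivity of `ψ` enters here: applied entrywise to the Gram matrix of the support of
`f`, it yields a positive matrix. -/
theorem kernelForm_kernel_self_nonneg (f : E →₀ C) : 0 ≤ kernelForm (kernel ψ) f f :=
  kernelForm_self_nonneg f <|
    ψ.map_cstarMatrix_nonneg _ (CStarModule.gram_nonneg fun x : f.support => (x : E))

variable (ψ E)

/-- The semi-inner product, relative to the bare norm from which the seminormed group structure is
built. -/
noncomputable abbrev preCStarModuleAux : PreCStarModule Cᵐᵒᵖ (PreInteriorTensor ψ E) where
  inner f g := op (kernelForm (kernel ψ) f g)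
  inner_add_right f g h := congrArg op (kernelForm_add_right _ f g h)
  inner_self_nonneg f := op_nonneg.2 (kernelForm_kernel_self_nonneg f)
  inner_op_smul_right a f g := congrArg op (kernelForm_op_smul_right _ f g a)
  inner_smul_right_complex z f g := congrArg op (kernelForm_smul_right _ f g z)
  star_inner f g := congrArg op (star_kernelForm star_kernel f g)
  norm_eq_sqrt_norm_inner_self _ := rfl

noncomputable instance : SeminormedAddCommGroup (PreInteriorTensor ψ E) :=
  letI := preCStarModuleAux ψ E
  SeminormedAddCommGroup.ofCore (PreCStarModule.seminormedSpaceCore Cᵐᵒᵖ (PreInteriorTensor ψ E))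

noncomputable instance : NormedSpace ℂ (PreInteriorTensor ψ E) where
  norm_smul_le z f :=
    letI := preCStarModuleAux ψ E
    (PreCStarModule.norm_smul_complex Cᵐᵒᵖ z f).le

noncomputable instance : PreCStarModule Cᵐᵒᵖ (PreInteriorTensor ψ E) := preCStarModuleAux ψ E

instance : UniformContinuousConstSMul Cᵐᵒᵖ (PreInteriorTensor ψ E) :=
  PreCStarModule.uniformContinuousConstSMul _ _

end PreInteriorTensor

end InteriorTensor

section InteriorTensor

variable {B C : Type*}
  [CStarAlgebra B] [PartialOrder B] [StarOrderedRing B]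
  [CStarAlgebra C] [PartialOrder C] [StarOrderedRing C]
  (ψ : B →CP C) (E : Type*) [NormedAddCommGroup E] [NormedSpace ℂ E]
  [Module Bᵐᵒᵖ E] [CStarModule Bᵐᵒᵖ E]

open UniformSpace

/-! ### Operators `T ⊗ 1` on formal sums -/

namespace PreInteriorTensor

variable {E}

/-- The map `e ⊗ c ↦ T e ⊗ c`. -/
noncomputable def map (T : adjointable Bᵐᵒᵖ E) :
    PreInteriorTensor ψ E →ₗ[ℂ] PreInteriorTensor ψ E :=
  Finsupp.lmapDomain C ℂ T.1

variable {ψ}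

theorem inner_map_right (T : adjointable Bᵐᵒᵖ E) (f g : PreInteriorTensor ψ E) :
    ⟪f, map ψ T g⟫_Cᵐᵒᵖ = op (kernelForm (fun x y => kernel ψ x (T.1 y)) f g) :=
  congrArg op (kernelForm_mapDomain_right _ _ f g)

theorem inner_map_left (T : adjointable Bᵐᵒᵖ E) (f g : PreInteriorTensor ψ E) :
    ⟪map ψ T f, g⟫_Cᵐᵒᵖ = ⟪f, map ψ (star T) g⟫_Cᵐᵒᵖ := by
  rw [inner_map_right]
  refine congrArg op ((kernelForm_mapDomain_left _ _ f g).trans ?_)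
  simp only [kernel, adjointable.inner_star_right]

/-- On formal sums `(Se + Te) ⊗ c` differs from `Se ⊗ c + Te ⊗ c`; they agree only after pairing, by
additivity of the kernel. -/
theorem inner_map_add_right (S T : adjointable Bᵐᵒᵖ E) (f g : PreInteriorTensor ψ E) :
    ⟪f, map ψ (S + T) g⟫_Cᵐᵒᵖ = ⟪f, map ψ S g⟫_Cᵐᵒᵖ + ⟪f, map ψ T g⟫_Cᵐᵒᵖ := by
  rw [inner_map_right, inner_map_right, inner_map_right, ← op_add]
  refine congrArg op ((congrArg (kernelForm · f g) (funext₂ fun x y => ?_)).trans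
    (kernelForm_add (fun x y => kernel ψ x (S.1 y)) (fun x y => kernel ψ x (T.1 y)) f g))
  change ψ (unop ⟪x, S.1 y + T.1 y⟫_Bᵐᵒᵖ) = _
  rw [CStarModule.inner_add_right, unop_add, map_add]
  rfl

theorem inner_map_smul_right (z : ℂ) (T : adjointable Bᵐᵒᵖ E) (f g : PreInteriorTensor ψ E) :
    ⟪f, map ψ (z • T) g⟫_Cᵐᵒᵖ = z • ⟪f, map ψ T g⟫_Cᵐᵒᵖ := by
  rw [inner_map_right, inner_map_right, ← op_smul]
  refine congrArg op ((congrArg (kernelForm · f g) (funext₂ fun x y => ?_)).trans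
    (kernelForm_smul z (fun x y => kernel ψ x (T.1 y)) f g))
  change ψ (unop ⟪x, z • T.1 y⟫_Bᵐᵒᵖ) = _
  rw [CStarModule.inner_smul_right_complex, unop_smul, map_smul]
  rfl

theorem map_one : map ψ (1 : adjointable Bᵐᵒᵖ E) = LinearMap.id :=
  Finsupp.lmapDomain_id C ℂ

theorem map_mul (S T : adjointable Bᵐᵒᵖ E) : map ψ (S * T) = map ψ S ∘ₗ map ψ T :=
  Finsupp.lmapDomain_comp C ℂ T.1 S.1

/-- Write `‖T‖² - T⋆T = S⋆S` in the C⋆-algebra of adjointable operators. Then `‖T‖²⟨f, f⟩` is the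
sum of the squares of `(S ⊗ 1)f` and `(T ⊗ 1)f`, so it dominates the latter. -/
theorem norm_map_le [CompleteSpace E] (T : adjointable Bᵐᵒᵖ E) (f : PreInteriorTensor ψ E) :
    ‖map ψ T f‖ ≤ ‖T‖ * ‖f‖ := by
  have h0 : 0 ≤ algebraMap ℝ (adjointable Bᵐᵒᵖ E) (‖T‖ ^ 2) - star T * T :=
    sub_nonneg.2 CStarAlgebra.star_mul_le_algebraMap_norm_sq
  obtain ⟨S, hS⟩ := CStarAlgebra.exists_eq_star_mul_self h0
  have h1 : ((‖T‖ ^ 2 : ℝ) : ℂ) • (1 : adjointable Bᵐᵒᵖ E) = star S * S + star T * T := by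
    rw [← hS, sub_add_cancel, Algebra.algebraMap_eq_smul_one, Complex.coe_smul]
  have h2 : ((‖T‖ ^ 2 : ℝ) : ℂ) • ⟪f, f⟫_Cᵐᵒᵖ
      = ⟪map ψ S f, map ψ S f⟫_Cᵐᵒᵖ + ⟪map ψ T f, map ψ T f⟫_Cᵐᵒᵖ := by
    have h := inner_map_smul_right ((‖T‖ ^ 2 : ℝ) : ℂ) 1 f f
    rw [h1, inner_map_add_right, PreInteriorTensor.map_mul,
      PreInteriorTensor.map_mul, LinearMap.comp_apply, LinearMap.comp_apply,
      ← inner_map_left, ← inner_map_left, PreInteriorTensor.map_one, LinearMap.id_apply] at h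
    exact h.symm
  have h3 : ⟪map ψ T f, map ψ T f⟫_Cᵐᵒᵖ ≤ ((‖T‖ ^ 2 : ℝ) : ℂ) • ⟪f, f⟫_Cᵐᵒᵖ := by
    rw [h2]
    exact le_add_of_nonneg_left (PreCStarModule.inner_self_nonneg _)
  refine le_of_sq_le_sq ?_ (by positivity)
  rw [mul_pow, PreCStarModule.norm_sq_eq (R := Cᵐᵒᵖ) (map ψ T f),
    PreCStarModule.norm_sq_eq (R := Cᵐᵒᵖ) f]
  refine (CStarAlgebra.norm_le_norm_of_nonneg_of_le
    (ha := PreCStarModule.inner_self_nonneg _) h3).trans_eq ?_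
  rw [norm_smul, Complex.norm_real, Real.norm_of_nonneg (by positivity)]

end PreInteriorTensor

/-- The interior tensor product `E ⊗_ψ C`, a Hilbert `C`-module. -/
abbrev InteriorTensor : Type _ := Completion (PreInteriorTensor ψ E)

namespace InteriorTensor

open PreInteriorTensor

variable {ψ E}

/-- By density, identities that hold only inside inner products of formal sums become operator
identities. -/
theorem adjointable_ext {S T : adjointable Cᵐᵒᵖ (InteriorTensor ψ E)}
    (h : ∀ f g : PreInteriorTensor ψ E, ⟪(f : InteriorTensor ψ E), S.1 g⟫_Cᵐᵒᵖ
      = ⟪(f : InteriorTensor ψ E), T.1 g⟫_Cᵐᵒᵖ) : S = T :=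
  adjointable.ext_of_inner fun x y => Completion.induction_on₂ x y
    (isClosed_eq
      (PreCStarModule.continuous_inner_completion.comp
        (continuous_fst.prodMk (S.1.continuous.comp continuous_snd)))
      (PreCStarModule.continuous_inner_completion.comp
        (continuous_fst.prodMk (T.1.continuous.comp continuous_snd)))) h

variable [CompleteSpace E]

variable (ψ) in
/-- The bounded operator `T ⊗ 1` on `E ⊗_ψ C`. -/
noncomputable def mapL (T : adjointable Bᵐᵒᵖ E) : InteriorTensor ψ E →L[ℂ] InteriorTensor ψ E :=
  ((Completion.toComplL (𝕜 := ℂ)).toLinearMap ∘ₗ map ψ T).extendOfNorm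
    (Completion.toComplL (𝕜 := ℂ) (E := PreInteriorTensor ψ E)).toLinearMap

theorem mapL_coe (T : adjointable Bᵐᵒᵖ E) (f : PreInteriorTensor ψ E) :
    mapL ψ T (f : InteriorTensor ψ E) = (map ψ T f : InteriorTensor ψ E) :=
  LinearMap.extendOfNorm_eq Completion.denseRange_coe
    ⟨‖T‖, fun g => by
      change ‖((map ψ T g : PreInteriorTensor ψ E) : InteriorTensor ψ E)‖
        ≤ ‖T‖ * ‖(g : InteriorTensor ψ E)‖
      rw [Completion.norm_coe, Completion.norm_coe]
      exact norm_map_le T g⟩ f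

theorem inner_mapL_left (T : adjointable Bᵐᵒᵖ E) (x y : InteriorTensor ψ E) :
    ⟪mapL ψ T x, y⟫_Cᵐᵒᵖ = ⟪x, mapL ψ (star T) y⟫_Cᵐᵒᵖ :=
  Completion.induction_on₂ x y
    (isClosed_eq
      (PreCStarModule.continuous_inner_completion.comp
        (((mapL ψ T).continuous.comp continuous_fst).prodMk continuous_snd))
      (PreCStarModule.continuous_inner_completion.comp
        (continuous_fst.prodMk ((mapL ψ (star T)).continuous.comp continuous_snd))))
    fun f g => by
      rw [mapL_coe, mapL_coe, PreCStarModule.inner_coe, PreCStarModule.inner_coe, inner_map_left]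

variable (ψ) in
/-- The adjointable operator `T ⊗ 1` on `E ⊗_ψ C`. -/
noncomputable def mapAdjointable (T : adjointable Bᵐᵒᵖ E) :
    adjointable Cᵐᵒᵖ (InteriorTensor ψ E) :=
  ⟨mapL ψ T, mapL ψ (star T), inner_mapL_left T⟩

theorem mapAdjointable_coe (T : adjointable Bᵐᵒᵖ E) (f : PreInteriorTensor ψ E) :
    (mapAdjointable ψ T).1 (f : InteriorTensor ψ E) = (map ψ T f : InteriorTensor ψ E) :=
  mapL_coe T f

theorem mapAdjointable_smul (z : ℂ) (T : adjointable Bᵐᵒᵖ E) :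
    mapAdjointable ψ (z • T) = z • mapAdjointable ψ T :=
  adjointable_ext fun f g => by
    have h : ⟪(f : InteriorTensor ψ E), (z • mapAdjointable ψ T).1 g⟫_Cᵐᵒᵖ
        = z • ⟪(f : InteriorTensor ψ E), (mapAdjointable ψ T).1 g⟫_Cᵐᵒᵖ :=
      CStarModule.inner_smul_right_complex (A := Cᵐᵒᵖ) (z := z)
        (x := (f : InteriorTensor ψ E)) (y := (mapAdjointable ψ T).1 g)
    rw [h, mapAdjointable_coe, mapAdjointable_coe,
      PreCStarModule.inner_coe, PreCStarModule.inner_coe, inner_map_smul_right]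

theorem mapAdjointable_one :
    mapAdjointable ψ (1 : adjointable Bᵐᵒᵖ E) = 1 :=
  adjointable_ext fun f g => by
    rw [mapAdjointable_coe, PreInteriorTensor.map_one]
    rfl

variable (ψ E) in
/-- The unital ⋆-homomorphism `T ↦ T ⊗ 1`. -/
noncomputable def mapHom : adjointable Bᵐᵒᵖ E →⋆ₐ[ℂ] adjointable Cᵐᵒᵖ (InteriorTensor ψ E) where
  toFun := mapAdjointable ψ
  map_one' := mapAdjointable_one
  map_mul' S T := adjointable_ext fun f g => by
    change _ = ⟪(f : InteriorTensor ψ E),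
      (mapAdjointable ψ S).1 ((mapAdjointable ψ T).1 g)⟫_Cᵐᵒᵖ
    rw [mapAdjointable_coe, mapAdjointable_coe, mapAdjointable_coe,
      PreInteriorTensor.map_mul, LinearMap.comp_apply]
  -- On formal sums the zero operator sends `e ⊗ c` to the null vector `0 ⊗ c`, not to `0`;
  -- homogeneity settles the case.
  map_zero' := by
    rw [← zero_smul ℂ (0 : adjointable Bᵐᵒᵖ E), mapAdjointable_smul, zero_smul]
  map_add' S T := adjointable_ext fun f g => by
    have h : ⟪(f : InteriorTensor ψ E), (mapAdjointable ψ S + mapAdjointable ψ T).1 g⟫_Cᵐᵒᵖ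
        = ⟪(f : InteriorTensor ψ E), (mapAdjointable ψ S).1 g⟫_Cᵐᵒᵖ
          + ⟪(f : InteriorTensor ψ E), (mapAdjointable ψ T).1 g⟫_Cᵐᵒᵖ :=
      CStarModule.inner_add_right (A := Cᵐᵒᵖ) (x := (f : InteriorTensor ψ E))
        (y := (mapAdjointable ψ S).1 g) (z := (mapAdjointable ψ T).1 g)
    rw [h]
    simp only [mapAdjointable_coe, PreCStarModule.inner_coe, inner_map_add_right]
  commutes' z := by
    rw [Algebra.algebraMap_eq_smul_one, Algebra.algebraMap_eq_smul_one, mapAdjointable_smul,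
      mapAdjointable_one]
  map_star' T := adjointable.ext_of_inner fun x y => by
    rw [adjointable.inner_star_right]
    exact (inner_mapL_left T x y).symm

end InteriorTensor

end InteriorTensor

/-! ### The completely bounded norm under ⋆-homomorphisms -/

/-- Entrywise application of `π` is a ⋆-homomorphism between matrix C⋆-algebras, hence contractive
at every size `n`. -/
theorem cbNorm_comp_le {A D F : Type*}
    [CStarAlgebra A] [PartialOrder A] [StarOrderedRing A]
    [CStarAlgebra D] [PartialOrder D] [StarOrderedRing D]
    [CStarAlgebra F] [PartialOrder F] [StarOrderedRing F]
    (π : D →⋆ₐ[ℂ] F) (f : A →ₗ[ℂ] D) :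
    cbNorm (π.toAlgHom.toLinearMap ∘ₗ f) ≤ cbNorm f := by
  refine iSup_mono fun n => iSup_mono fun M => iSup_mono fun _ => ENNReal.ofReal_le_ofReal ?_
  exact NonUnitalStarAlgHom.norm_apply_le (CStarMatrix.mapₙₐ (π : D →⋆ₙₐ[ℂ] F)) (M.map f)

/-! ### Joint representations of compositions -/

namespace JointRepresentation

variable {A : Type u} {B C : Type v}
  [CStarAlgebra A] [PartialOrder A] [StarOrderedRing A]
  [CStarAlgebra B] [PartialOrder B] [StarOrderedRing B]
  [CStarAlgebra C] [PartialOrder C] [StarOrderedRing C]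
  {φ₁ φ₂ : UCP A B}

/-- The vector `x ⊗ 1`. -/
noncomputable def tensorOne (T : JointRepresentation φ₁ φ₂) (ψ : UCP B C) :
    PreInteriorTensor ψ.toCompletelyPositiveMap T.E :=
  Finsupp.single T.x (1 : C)

/-- Taking `S = 1` shows that `x ⊗ 1` is a unit vector; taking `S = σᵢ(a)` recovers `ψ(φᵢ(a))`. -/
theorem inner_tensorOne (T : JointRepresentation φ₁ φ₂) (ψ : UCP B C) (S : adjointable Bᵐᵒᵖ T.E) :
    unop ⟪(T.tensorOne ψ : InteriorTensor ψ.toCompletelyPositiveMap T.E),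
      (InteriorTensor.mapHom ψ.toCompletelyPositiveMap T.E S).1 (T.tensorOne ψ)⟫_Cᵐᵒᵖ
      = ψ (unop ⟪T.x, S.1 T.x⟫_Bᵐᵒᵖ) := by
  refine congrArg unop ((congrArg _ (InteriorTensor.mapAdjointable_coe S _)).trans
    (PreCStarModule.inner_coe _ _)) |>.trans ?_
  rw [PreInteriorTensor.inner_map_right, unop_op, tensorOne, kernelForm_single, star_one, one_mul,
    mul_one]
  rfl

/-- The joint representation of `(ψ ∘ φ₁, ψ ∘ φ₂)` on `E ⊗_ψ C`. -/
noncomputable def compUCP (T : JointRepresentation φ₁ φ₂) (ψ : UCP B C) :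
    JointRepresentation (ψ.comp φ₁) (ψ.comp φ₂) where
  -- As `B` and `C` share a universe, this module stays in the universe over which the infimum
  -- ranges.
  E := InteriorTensor ψ.toCompletelyPositiveMap T.E
  σ₁ := (InteriorTensor.mapHom ψ.toCompletelyPositiveMap T.E).comp T.σ₁
  σ₂ := (InteriorTensor.mapHom ψ.toCompletelyPositiveMap T.E).comp T.σ₂
  x := (T.tensorOne ψ : InteriorTensor ψ.toCompletelyPositiveMap T.E)
  inner_self_eq_one := by
    have h := T.inner_tensorOne ψ 1
    rw [map_one] at h
    exact h.trans ((congrArg ψ T.inner_self_eq_one).trans ψ.map_one')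
  inner_left a := (congrArg ψ (T.inner_left a)).trans (T.inner_tensorOne ψ (T.σ₁ a)).symm
  inner_right a := (congrArg ψ (T.inner_right a)).trans (T.inner_tensorOne ψ (T.σ₂ a)).symm

theorem cbDist_compUCP_le (T : JointRepresentation φ₁ φ₂) (ψ : UCP B C) :
    (T.compUCP ψ).cbDist ≤ T.cbDist := by
  refine le_trans (le_of_eq ?_) (cbNorm_comp_le
    (InteriorTensor.mapHom ψ.toCompletelyPositiveMap T.E)
    (T.σ₁.toAlgHom.toLinearMap - T.σ₂.toAlgHom.toLinearMap))
  rw [LinearMap.comp_sub]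
  rfl

end JointRepresentation

theorem mainTheorem7 {A : Type u} {B C : Type v}
    [CStarAlgebra A] [PartialOrder A] [StarOrderedRing A]
    [CStarAlgebra B] [PartialOrder B] [StarOrderedRing B]
    [CStarAlgebra C] [PartialOrder C] [StarOrderedRing C]
    (φ₁ φ₂ : UCP A B) (ψ : UCP B C) :
    repDist (ψ.comp φ₁) (ψ.comp φ₂) ≤ repDist φ₁ φ₂ :=
  le_iInf fun T => (iInf_le _ (T.compUCP ψ)).trans (T.cbDist_compUCP_le ψ)
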